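/- Let $\mathcal{L}$ be a language consisting of finitary operation symbols (constants allowed), and let $\mathcal{V}$ be a variety of (nonempty) $\mathcal{L}$-algebras, i.e. the class of all algebras satisfying some set of identities. For $\mathbf{A}\in\mathcal{V}$ and $a,b\in A$ let $\theta^{\mathbf{A}}(a,b)$ be the least congruence of $\mathbf{A}$ containing $(a,b)$. A formula $\varphi(x,y,z,w)$ of $\mathcal{L}$ defines the principal congruences in $\mathcal{V}$ if $$\theta^{\mathbf{A}}(a,b)=\{(c,d)\in A^2:\mathbf{A}\vDash\varphi(a,b,c,d)\}\quad\text{for all }\mathbf{A}\in\mathcal{V},\ a,b\in A.$$ Suppose that $\mathcal{V}$ has definable principal congruences, i.e. that some first-order formula $\varphi(x,y,z,w)$ of $\mathcal{L}$ defines the principal congruences in $\mathcal{V}$. Then the following are equivalent. (1) $\mathcal{V}$ has equationally definable principal congruences (in the restricted sense): some finite conjunction $\varphi(x,y,z,w)$ of atomic $\mathcal{L}$-formulas, i.e. of equations $p(x,y,z,w)=q(x,y,z,w)$ between $\mathcal{L}$-terms, without quantifiers, defines the principal congruences in $\mathcal{V}$. (2) $\mathcal{V}$ has the congruence extension property (for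 every $\mathbf{B}\in\mathcal{V}$, every subalgebra $\mathbf{A}\leq\mathbf{B}$ and every congruence $\theta$ of $\mathbf{A}$ there is a congruence $\delta$ of $\mathbf{B}$ with $\theta=\delta\cap A^2$), and $\mathcal{V}$ has the Fraser–Horn property (for all $\mathbf{A}_1,\mathbf{A}_2\in\mathcal{V}$ and every congruence $\theta$ of $\mathbf{A}_1\times\mathbf{A}_2$ there are congruences $\theta_1$ of $\mathbf{A}_1$ and $\theta_2$ of $\mathbf{A}_2$ such that $\theta=\theta_1\times\theta_2$, i.e. $((a_1,a_2),(b_1,b_2))\in\theta$ if and only if $(a_1,b_1)\in\theta_1$ and $(a_2,b_2)\in\theta_2$). -/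

import Mathlib

universe u v w

namespace UniversalAlgebra

/-- An identity `s ≈ t` of the language `L`, in the variables `x₀, x₁, x₂, …`. -/
abbrev Identity (L : FirstOrder.Language.{u, v}) : Type u := L.Term ℕ × L.Term ℕ

/-- Membership of the structure `A` in the variety axiomatized by the set `E` of identities. -/
def InVariety {L : FirstOrder.Language.{u, v}} (E : Set (Identity L)) (A : Type w) [L.Structure A] : Prop :=
  ∀ e ∈ E, ∀ x : ℕ → A, e.1.realize x = e.2.realize x

/-- A congruence of the structure `A` of an algebraic language: an equivalence relation
compatible with all the basic operations. -/
structure Congruence (L : FirstOrder.Language.{u, v}) (A : Type w) [L.Structure A] extends Setoid A where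
  funMap_rel : ∀ {n : ℕ} (f : L.Functions n) (x y : Fin n → A), (∀ i, r (x i) (y i)) →
    r (FirstOrder.Language.Structure.funMap f x) (FirstOrder.Language.Structure.funMap f y)

/-- The principal congruence `θ(a, b)`: the intersection of all congruences that contain
`(a, b)`, hence the least such congruence. -/
def principalCongruence (L : FirstOrder.Language.{u, v}) {A : Type w} [L.Structure A] (a b : A) :
    Congruence L A where
  r c d := ∀ θ : Congruence L A, θ.r a b → θ.r c d
  iseqv :=
    { refl := fun c θ _ => θ.iseqv.refl c
      symm := fun h θ hab => θ.iseqv.symm (h θ hab)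
      trans := fun h₁ h₂ θ hab => θ.iseqv.trans (h₁ θ hab) (h₂ θ hab) }
  funMap_rel f x y h θ hab := θ.funMap_rel f x y fun i => h i θ hab

/-- The direct product of two structures. -/
instance prodStructure (L : FirstOrder.Language.{u, v}) (A B : Type w) [L.Structure A] [L.Structure B] :
    L.Structure (A × B) where
  funMap f x := (FirstOrder.Language.Structure.funMap f fun i => (x i).1,
    FirstOrder.Language.Structure.funMap f fun i => (x i).2)
  RelMap R x := FirstOrder.Language.Structure.RelMap R (fun i => (x i).1) ∧
    FirstOrder.Language.Structure.RelMap R (fun i => (x i).2)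

/-- The finite nonempty conjunctions of atomic formulas. Over an algebraic language the atomic
formulas are the equations between terms. -/
inductive IsConjAtomic {L : FirstOrder.Language.{u, v}} {α : Type w} : L.Formula α → Prop
  | atomic {φ : L.Formula α} (h : φ.IsAtomic) : IsConjAtomic φ
  | and {φ ψ : L.Formula α} (hφ : IsConjAtomic φ) (hψ : IsConjAtomic ψ) :
      IsConjAtomic (φ ⊓ ψ)

/-- The formula `φ(x, y, z, w)` defines the principal congruences in the variety of `E`. -/
def DefinesPrincipalCongruences.{u₁, v₁, w₁} {L : FirstOrder.Language.{u₁, v₁}} (E : Set (Identity L))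
    (φ : L.Formula (Fin 4)) : Prop :=
  ∀ (A : Type w₁) [L.Structure A] [Nonempty A], InVariety E A →
    ∀ a b c d : A, (principalCongruence L a b).r c d ↔ φ.Realize ![a, b, c, d]

/-- Definable principal congruences: some first-order formula defines them. -/
def HasDPC.{u₁, v₁, w₁} {L : FirstOrder.Language.{u₁, v₁}} (E : Set (Identity L)) : Prop :=
  ∃ φ : L.Formula (Fin 4), DefinesPrincipalCongruences.{u₁, v₁, w₁} E φ

/-- Equationally definable principal congruences: some conjunction of atomic formulas,
without quantifiers, defines them. -/
def HasEDPC.{u₁, v₁, w₁} {L : FirstOrder.Language.{u₁, v₁}} (E : Set (Identity L)) : Prop :=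
  ∃ φ : L.Formula (Fin 4), IsConjAtomic φ ∧ DefinesPrincipalCongruences.{u₁, v₁, w₁} E φ

/-- The congruence extension property: every congruence of a subalgebra `A` of a member `B` of
the variety is the restriction to `A` of a congruence of `B`. -/
def HasCEP.{u₁, v₁, w₁} {L : FirstOrder.Language.{u₁, v₁}} (E : Set (Identity L)) : Prop :=
  ∀ (B : Type w₁) [L.Structure B] [Nonempty B], InVariety E B →
    ∀ (A : L.Substructure B) [Nonempty A] (θ : Congruence L A),
      ∃ δ : Congruence L B, ∀ x y : A, θ.r x y ↔ δ.r (x : B) (y : B)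

/-- The Fraser-Horn property: every congruence of a product of two members of the variety is a
product of congruences of the factors. -/
def HasFraserHorn.{u₁, v₁, w₁} {L : FirstOrder.Language.{u₁, v₁}} (E : Set (Identity L)) : Prop :=
  ∀ (A₁ A₂ : Type w₁) [L.Structure A₁] [L.Structure A₂] [Nonempty A₁] [Nonempty A₂],
    InVariety E A₁ → InVariety E A₂ → ∀ θ : Congruence L (A₁ × A₂),
      ∃ (θ₁ : Congruence L A₁) (θ₂ : Congruence L A₂),
        ∀ x y : A₁ × A₂, θ.r x y ↔ θ₁.r x.1 y.1 ∧ θ₂.r x.2 y.2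

end UniversalAlgebra

/-! A conjunction of equations is evaluated coordinatewise in products and is reflected by
embeddings. So with EDPC, principal congruences of a product are products of principal ones, which
gives Fraser–Horn, and they restrict correctly to subalgebras, which gives CEP by a Zorn argument.

Conversely, let Σ be the equations forced by `(x₂, x₃) ∈ θ(x₀, x₁)`. Fraser–Horn lets products
witness finitely many non-forced equations failing at once; definability and compactness then give a
generic quadruple `y` satisfying exactly Σ. If `x` satisfies Σ, the assignment `yᵢ ↦ xᵢ` extends to
a homomorphism on the subalgebra generated by `y`, and CEP transfers the membership from `y` to `x`.
So Σ defines principal congruences, and compactness makes it finite. -/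

namespace UniversalAlgebra

open FirstOrder FirstOrder.Language

/-! ### Homomorphisms, products and preservation of equations -/

section Basic

variable {L : FirstOrder.Language.{u, v}}

/-- A map compatible with all operations of an algebraic language is a homomorphism. -/
def homOfMapFun [L.IsAlgebraic] {A B : Type*} [L.Structure A] [L.Structure B] (f : A → B)
    (hf : ∀ {n : ℕ} (F : L.Functions n) (x : Fin n → A),
      f (Structure.funMap F x) = Structure.funMap F (f ∘ x)) : A →[L] B where
  toFun := f
  map_fun' := hf
  map_rel' r := isEmptyElim r

/-- The first projection of a direct product. -/
def fstHom [L.IsAlgebraic] (A B : Type w) [L.Structure A] [L.Structure B] : A × B →[L] A :=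
  homOfMapFun Prod.fst fun _ _ => rfl

/-- The second projection of a direct product. -/
def sndHom [L.IsAlgebraic] (A B : Type w) [L.Structure A] [L.Structure B] : A × B →[L] B :=
  homOfMapFun Prod.snd fun _ _ => rfl

theorem realize_fst [L.IsAlgebraic] {A B : Type w} {α : Type*} [L.Structure A] [L.Structure B] (t : L.Term α)
    (x : α → A × B) : (t.realize x).1 = t.realize fun i => (x i).1 :=
  (HomClass.realize_term (fstHom (L := L) A B)).symm

theorem realize_snd [L.IsAlgebraic] {A B : Type w} {α : Type*} [L.Structure A] [L.Structure B] (t : L.Term α)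
    (x : α → A × B) : (t.realize x).2 = t.realize fun i => (x i).2 :=
  (HomClass.realize_term (sndHom (L := L) A B)).symm

theorem InVariety.of_injective {E : Set (Identity L)} {A B : Type*} [L.Structure A]
    [L.Structure B] (hB : InVariety E B) (f : A →[L] B) (hf : Function.Injective f) :
    InVariety E A := fun e he x => hf <| by
  rw [← HomClass.realize_term, ← HomClass.realize_term]
  exact hB e he _

theorem InVariety.of_surjective {E : Set (Identity L)} {A B : Type*} [L.Structure A]
    [L.Structure B] (hA : InVariety E A) (f : A →[L] B) (hf : Function.Surjective f) :
    InVariety E B := fun e he x => by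
  obtain ⟨y, rfl⟩ := hf.comp_left x
  exact (HomClass.realize_term f).trans <|
    (congrArg f (hA e he y)).trans (HomClass.realize_term f).symm

theorem InVariety.prod [L.IsAlgebraic] {E : Set (Identity L)} {A B : Type w} [L.Structure A]
    [L.Structure B] (hA : InVariety E A) (hB : InVariety E B) : InVariety E (A × B) :=
  fun e he x => Prod.ext
    (by rw [realize_fst, realize_fst]; exact hA e he _)
    (by rw [realize_snd, realize_snd]; exact hB e he _)

/-- Absence of quantifiers matters here: an existential witness in `B` need not lie in the image of
`f`. -/
theorem IsConjAtomic.realize_comp_iff [L.IsAlgebraic] {α A B : Type*} [L.Structure A] [L.Structure B]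
    {φ : L.Formula α} (hφ : IsConjAtomic φ) (f : A →[L] B) (hf : Function.Injective f)
    (x : α → A) : φ.Realize (f ∘ x) ↔ φ.Realize x := by
  induction hφ with
  | atomic h =>
    cases h with
    | equal t₁ t₂ =>
      have hx : Sum.elim (f ∘ x) (default : Fin 0 → B) = f ∘ Sum.elim x default := by
        ext i
        rcases i with i | i
        · rfl
        · exact i.elim0
      rw [Formula.Realize, Formula.Realize, BoundedFormula.realize_bdEqual,
        BoundedFormula.realize_bdEqual, hx, HomClass.realize_term f, HomClass.realize_term f, hf.eq_iff]
    | rel R ts => exact isEmptyElim R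
  | and _ _ ih₁ ih₂ => rw [Formula.realize_inf, Formula.realize_inf, ih₁, ih₂]

theorem IsConjAtomic.realize_prod_iff [L.IsAlgebraic] {α : Type*} {A B : Type w} [L.Structure A] [L.Structure B]
    {φ : L.Formula α} (hφ : IsConjAtomic φ) (x : α → A × B) :
    φ.Realize x ↔ (φ.Realize fun i => (x i).1) ∧ φ.Realize fun i => (x i).2 := by
  induction hφ with
  | atomic h =>
    cases h with
    | equal t₁ t₂ =>
      have h₁ : (fun i => (Sum.elim x (default : Fin 0 → A × B) i).1) =
          Sum.elim (fun i => (x i).1) default := by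
        ext i
        rcases i with i | i
        · rfl
        · exact i.elim0
      have h₂ : (fun i => (Sum.elim x (default : Fin 0 → A × B) i).2) =
          Sum.elim (fun i => (x i).2) default := by
        ext i
        rcases i with i | i
        · rfl
        · exact i.elim0
      simp only [Formula.Realize, BoundedFormula.realize_bdEqual]
      rw [Prod.ext_iff, realize_fst, realize_fst, realize_snd, realize_snd, h₁, h₂]
    | rel R ts => exact isEmptyElim R
  | and _ _ ih₁ ih₂ => simp only [Formula.realize_inf, ih₁, ih₂]; tauto

theorem exists_isConjAtomic_realize_iff (s : Finset (L.Term (Fin 4) × L.Term (Fin 4))) :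
    ∃ ψ : L.Formula (Fin 4), IsConjAtomic ψ ∧ ∀ (A : Type w) [L.Structure A] (x : Fin 4 → A),
      ψ.Realize x ↔ ∀ e ∈ s, e.1.realize x = e.2.realize x := by
  classical
  induction s using Finset.induction_on with
  | empty =>
    -- Conjunctions must be nonempty, so a trivial equation stands for the empty one.
    exact ⟨(Term.var 0).equal (Term.var 0), .atomic (.equal _ _), fun A _ x => by simp⟩
  | insert e s _ ih =>
    obtain ⟨ψ, hψ, h⟩ := ih
    refine ⟨e.1.equal e.2 ⊓ ψ, .and (.atomic (.equal _ _)) hψ, fun A _ x => ?_⟩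
    rw [Formula.realize_inf, Formula.realize_equal, h, Finset.forall_mem_insert]

/-! ### Congruences, images, quotients and unions of chains -/

namespace Congruence

/-- Congruences are ordered by inclusion. -/
instance (A : Type w) [L.Structure A] : Preorder (Congruence L A) :=
  Preorder.lift fun θ => θ.r

/-- The inverse image of a congruence under a homomorphism. -/
def comap {A B : Type*} [L.Structure A] [L.Structure B] (f : A →[L] B) (θ : Congruence L B) :
    Congruence L A where
  r x y := θ.r (f x) (f y)
  iseqv := ⟨fun _ => θ.iseqv.refl _, θ.iseqv.symm, θ.iseqv.trans⟩
  funMap_rel F x y h := by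
    rw [f.map_fun, f.map_fun]
    exact θ.funMap_rel F _ _ h

/-- The equality relation as a congruence. -/
def equality (A : Type w) [L.Structure A] : Congruence L A where
  r x y := x = y
  iseqv := eq_equivalence
  funMap_rel F x y h := by rw [funext h]

/-- The image of a congruence that contains the kernel of a homomorphism, on its range. -/
def mapRange {A B : Type*} [L.Structure A] [L.Structure B] (f : A →[L] B) (θ : Congruence L A)
    (hf : ∀ x y, f x = f y → θ.r x y) : Congruence L f.range where
  r p q := ∃ x y, f x = p ∧ f y = q ∧ θ.r x y
  iseqv :=
    { refl := by
        rintro ⟨_, x, rfl⟩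
        exact ⟨x, x, rfl, rfl, θ.iseqv.refl x⟩
      symm := by
        rintro p q ⟨x, y, hx, hy, h⟩
        exact ⟨y, x, hy, hx, θ.iseqv.symm h⟩
      trans := by
        rintro p q r ⟨x, y, hx, hy, h⟩ ⟨y', z, hy', hz, h'⟩
        exact ⟨x, z, hx, hz, θ.iseqv.trans h (θ.iseqv.trans (hf _ _ (hy.trans hy'.symm)) h')⟩ }
  funMap_rel F p q h := by
    choose x y hx hy hxy using h
    refine ⟨Structure.funMap F x, Structure.funMap F y, ?_, ?_, θ.funMap_rel F x y hxy⟩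
    · rw [f.map_fun, show f ∘ x = fun i => (p i : B) from funext hx]
      rfl
    · rw [f.map_fun, show f ∘ y = fun i => (q i : B) from funext hy]
      rfl

theorem mapRange_rel_iff {A B : Type*} [L.Structure A] [L.Structure B] (f : A →[L] B)
    (θ : Congruence L A) (hf : ∀ x y, f x = f y → θ.r x y) {p q : f.range} {x y : A}
    (hx : f x = p) (hy : f y = q) : (θ.mapRange f hf).r p q ↔ θ.r x y := by
  refine ⟨?_, fun h => ⟨x, y, hx, hy, h⟩⟩
  rintro ⟨x', y', hx', hy', h⟩
  exact θ.iseqv.trans (hf _ _ (hx.trans hx'.symm))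
    (θ.iseqv.trans h (hf _ _ (hy'.trans hy.symm)))

/-- The quotient algebra by a congruence. -/
instance quotientPrestructure [L.IsAlgebraic] {A : Type w} [hA : L.Structure A] (θ : Congruence L A) :
    L.Prestructure θ.toSetoid where
  toStructure := hA
  fun_equiv x y h := θ.funMap_rel _ x y h
  rel_equiv {_ r} := isEmptyElim r

/-- The canonical homomorphism onto the quotient algebra. -/
def quotientHom [L.IsAlgebraic] {A : Type w} [L.Structure A] (θ : Congruence L A) :
    A →[L] Quotient θ.toSetoid :=
  homOfMapFun (Quotient.mk θ.toSetoid) fun F x => (funMap_quotient_mk' θ.toSetoid F x).symm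

theorem quotientHom_surjective [L.IsAlgebraic] {A : Type w} [L.Structure A] (θ : Congruence L A) :
    Function.Surjective θ.quotientHom :=
  Quotient.mk_surjective

theorem quotientHom_eq_iff [L.IsAlgebraic] {A : Type w} [L.Structure A] (θ : Congruence L A) {x y : A} :
    θ.quotientHom x = θ.quotientHom y ↔ θ.r x y :=
  Quotient.eq (r := θ.toSetoid)

/-- The union of a nonempty chain of congruences. -/
def unionOfChain {A : Type w} [L.Structure A] (c : Set (Congruence L A))
    (hc : IsChain (· ≤ ·) c) (hne : c.Nonempty) : Congruence L A where
  r x y := ∃ θ ∈ c, θ.r x y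
  iseqv :=
    { refl := fun x => ⟨hne.some, hne.some_mem, hne.some.iseqv.refl x⟩
      symm := by
        rintro x y ⟨θ, hθ, h⟩
        exact ⟨θ, hθ, θ.iseqv.symm h⟩
      trans := by
        rintro x y z ⟨θ, hθ, h⟩ ⟨θ', hθ', h'⟩
        rcases hc.total hθ hθ' with hle | hle
        · exact ⟨θ', hθ', θ'.iseqv.trans (hle _ _ h) h'⟩
        · exact ⟨θ, hθ, θ.iseqv.trans h (hle _ _ h')⟩ }
  funMap_rel {n} F x y h := by
    choose θ hθ h using h
    have : Nonempty c := hne.to_subtype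
    -- Operations are finitary, so one member of the chain contains all the pairs.
    obtain ⟨m, hm⟩ := hc.directed.finite_le fun i : Fin n => (⟨θ i, hθ i⟩ : c)
    exact ⟨m, m.2, m.1.funMap_rel F x y fun i => hm i _ _ (h i)⟩

end Congruence

theorem principalCongruence_rel {A : Type w} [L.Structure A] (a b : A) :
    (principalCongruence L a b).r a b :=
  fun _ h => h

theorem principalCongruence_le {A : Type w} [L.Structure A] {a b : A} {θ : Congruence L A}
    (h : θ.r a b) {c d : A} (hcd : (principalCongruence L a b).r c d) : θ.r c d :=
  hcd θ h

end Basic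

/-! ### EDPC implies Fraser–Horn and CEP -/

section FromEDPC

variable {L : FirstOrder.Language.{u, v}} [L.IsAlgebraic] {E : Set (Identity L)}

theorem HasEDPC.principalCongruence_of_injective (h : HasEDPC.{u, v, w} E) {A B : Type w}
    [L.Structure A] [L.Structure B] [Nonempty A] [Nonempty B] (hB : InVariety E B)
    (f : A →[L] B) (hf : Function.Injective f) {a b c d : A}
    (hcd : (principalCongruence L (f a) (f b)).r (f c) (f d)) :
    (principalCongruence L a b).r c d := by
  obtain ⟨φ, hφ, hdef⟩ := h
  rw [hdef A (hB.of_injective f hf), ← hφ.realize_comp_iff f hf]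
  rw [hdef B hB] at hcd
  convert hcd using 1
  ext i
  fin_cases i <;> rfl

theorem HasEDPC.principalCongruence_prod (h : HasEDPC.{u, v, w} E) {A B : Type w}
    [L.Structure A] [L.Structure B] [Nonempty A] [Nonempty B] (hA : InVariety E A)
    (hB : InVariety E B) {a b c d : A × B} (h₁ : (principalCongruence L a.1 b.1).r c.1 d.1)
    (h₂ : (principalCongruence L a.2 b.2).r c.2 d.2) : (principalCongruence L a b).r c d := by
  obtain ⟨φ, hφ, hdef⟩ := h
  rw [hdef _ (hA.prod hB), hφ.realize_prod_iff]
  rw [hdef A hA] at h₁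
  rw [hdef B hB] at h₂
  refine ⟨?_, ?_⟩
  · convert h₁ using 1
    ext i
    fin_cases i <;> rfl
  · convert h₂ using 1
    ext i
    fin_cases i <;> rfl

theorem HasEDPC.hasFraserHorn (h : HasEDPC.{u, v, w} E) : HasFraserHorn.{u, v, w} E := by
  intro A₁ A₂ _ _ _ _ h₁ h₂ θ
  -- Replacing the second coordinates by a common `c` stays inside `θ(x, y)`, since `(c, c)` lies in
  -- every congruence.
  have left {x y : A₁ × A₂} (hxy : θ.r x y) (c : A₂) : θ.r (x.1, c) (y.1, c) :=
    principalCongruence_le hxy <| h.principalCongruence_prod h₁ h₂ (principalCongruence_rel _ _)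
      ((principalCongruence L x.2 y.2).iseqv.refl c)
  have right {x y : A₁ × A₂} (hxy : θ.r x y) (c : A₁) : θ.r (c, x.2) (c, y.2) :=
    principalCongruence_le hxy <| h.principalCongruence_prod h₁ h₂
      ((principalCongruence L x.1 y.1).iseqv.refl c) (principalCongruence_rel _ _)
  refine ⟨
    { r := fun x y => ∀ c, θ.r (x, c) (y, c)
      iseqv := ⟨fun _ _ => θ.iseqv.refl _, fun h c => θ.iseqv.symm (h c),
        fun h h' c => θ.iseqv.trans (h c) (h' c)⟩
      funMap_rel := fun F x y hxy c =>
        left (θ.funMap_rel F (fun i => (x i, c)) (fun i => (y i, c)) fun i => hxy i c) c },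
    { r := fun x y => ∀ c, θ.r (c, x) (c, y)
      iseqv := ⟨fun _ _ => θ.iseqv.refl _, fun h c => θ.iseqv.symm (h c),
        fun h h' c => θ.iseqv.trans (h c) (h' c)⟩
      funMap_rel := fun F x y hxy c =>
        right (θ.funMap_rel F (fun i => (c, x i)) (fun i => (c, y i)) fun i => hxy i c) c },
    fun x y => ⟨fun hxy => ⟨left hxy, right hxy⟩, fun hxy => ?_⟩⟩
  exact θ.iseqv.trans (hxy.1 x.2) (hxy.2 y.1)

theorem HasEDPC.hasCEP (h : HasEDPC.{u, v, w} E) : HasCEP.{u, v, w} E := by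
  intro B _ _ hB A _ θ
  -- Take `δ` maximal among congruences of `B` whose restriction to `A` lies in `θ`; maximality will
  -- force equality.
  obtain ⟨δ, -, hδ⟩ := zorn_le_nonempty₀
    {δ : Congruence L B | ∀ x y : A, δ.r x y → θ.r x y}
    (fun c hcS hc δ hδ => ⟨Congruence.unionOfChain c hc ⟨δ, hδ⟩,
      by rintro x y ⟨γ, hγ, hxy⟩; exact hcS hγ x y hxy,
      fun γ hγ x y hxy => ⟨γ, hγ, hxy⟩⟩)
    (Congruence.equality B) (fun x y hxy => by obtain rfl := Subtype.ext hxy; exact θ.iseqv.refl x)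
  refine ⟨δ, fun a b => ⟨fun hab => ?_, hδ.prop a b⟩⟩
  let g : A →[L] Quotient δ.toSetoid := δ.quotientHom.comp A.subtype.toHom
  have hg : ∀ x y, g x = g y → θ.r x y := fun x y hxy =>
    hδ.prop x y (δ.quotientHom_eq_iff.1 hxy)
  let g' (x : A) : g.range := ⟨g x, x, rfl⟩
  have : Nonempty g.range := ⟨g' a⟩
  have : Nonempty (Quotient δ.toSetoid) := ⟨g a⟩
  -- This is the join of `δ` with `θ(a, b)`, formed as a pullback from the quotient by `δ`. EDPC
  -- shows that its restriction to `A` still lies in `θ`.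
  let γ := (principalCongruence L (g a) (g b)).comap δ.quotientHom
  have hγ : ∀ x y : A, γ.r x y → θ.r x y := fun x y hxy => by
    have := h.principalCongruence_of_injective
      (hB.of_surjective _ δ.quotientHom_surjective) g.range.subtype.toHom
      Subtype.val_injective (a := g' a) (b := g' b) (c := g' x) (d := g' y) hxy
    exact (θ.mapRange_rel_iff g hg rfl rfl).1
      (principalCongruence_le ((θ.mapRange_rel_iff g hg rfl rfl).2 hab) this)
  refine hδ.le_of_ge (y := γ) hγ (fun x y hxy => ?_) _ _ (principalCongruence_rel (g a) (g b))
  change (principalCongruence L _ _).r (δ.quotientHom x) (δ.quotientHom y)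
  rw [δ.quotientHom_eq_iff.2 hxy]

end FromEDPC

/-! ### Compactness, the generic quadruple and the converse -/

section ToEDPC

/-- The compactness theorem for formulas with free variables. -/
theorem exists_realize_of_finitely_realizable {L : FirstOrder.Language.{u, v}} {α : Type}
    (Γ : Set (L.Formula α))
    (h : ∀ s : Finset (L.Formula α), ↑s ⊆ Γ → ∃ (A : Type (max u v w)) (_ : L.Structure A)
      (_ : Nonempty A) (x : α → A), ∀ φ ∈ s, φ.Realize x) :
    ∃ (A : Type (max u v w)) (_ : L.Structure A) (_ : Nonempty A) (x : α → A),
      ∀ φ ∈ Γ, φ.Realize x := by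
  classical
  have hsat : Theory.IsSatisfiable (Formula.equivSentence '' Γ : L[[α]].Theory) := by
    rw [Theory.isSatisfiable_iff_isFinitelySatisfiable]
    intro T hT
    obtain ⟨s, hs, rfl⟩ := (Finset.subset_set_image_iff).1 hT
    obtain ⟨A, _, _, x, hx⟩ := h s hs
    let _ := constantsOn.structure x
    have : A ⊨ ((s.image Formula.equivSentence : Finset _) : L[[α]].Theory) := by
      rw [Theory.model_iff]
      intro ψ hψ
      obtain ⟨φ, hφ, rfl⟩ := Finset.mem_image.1 (Finset.mem_coe.1 hψ)
      exact (Formula.realize_equivSentence A φ).2 (hx φ hφ)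
    exact Theory.Model.isSatisfiable A
  obtain ⟨M⟩ := hsat
  let N := Theory.ModelType.ulift.{_, _, _, w} M
  let _ : L.Structure N := (L.lhomWithConstants α).reduct N
  refine ⟨N, inferInstance, inferInstance, fun a => (L.con a : N), fun φ hφ => ?_⟩
  rw [← Formula.realize_equivSentence]
  exact Theory.realize_sentence_of_mem _ (Set.mem_image_of_mem _ hφ)

variable {L : FirstOrder.Language.{u, v}}

/-- Only finitely many variables occur in an identity, so its universal closure is first-order. -/
theorem exists_formula_realize_iff_identity (e : Identity L) (α : Type) :
    ∃ φ : L.Formula α, ∀ (A : Type w) [L.Structure A] [Nonempty A] (x : α → A),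
      φ.Realize x ↔ ∀ y : ℕ → A, e.1.realize y = e.2.realize y := by
  classical
  let ψ : L.Formula ℕ := e.1.equal e.2
  let χ : L.Formula (α ⊕ ψ.freeVarFinset) := BoundedFormula.restrictFreeVar ψ Sum.inr
  refine ⟨χ.iAlls ψ.freeVarFinset, fun A _ _ x => ?_⟩
  rw [Formula.realize_iAlls]
  constructor
  · intro h y
    exact (Formula.realize_equal (t₁ := e.1) (t₂ := e.2)).1
      ((BoundedFormula.realize_restrictFreeVar (φ := ψ) (f := Sum.inr) y fun _ => rfl).1
        (h fun i => y i))
  · intro h y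
    refine (BoundedFormula.realize_restrictFreeVar
      (fun n => if hn : n ∈ ψ.freeVarFinset then y ⟨n, hn⟩ else Classical.arbitrary A)
      fun a => ?_).2 (Formula.realize_equal.2 (h _))
    simp

/-- The compactness theorem for formulas with free variables, relative to a variety. -/
theorem exists_inVariety_realize_of_finitely_realizable {I : Type*} {α : Type}
    (E : Set (Identity L)) (φ : L.Formula α) (ν : I → L.Formula α) (S : Set I)
    (h : ∀ s : Finset I, ↑s ⊆ S → ∃ (A : Type (max u v w)) (_ : L.Structure A)
      (_ : Nonempty A) (x : α → A), InVariety E A ∧ φ.Realize x ∧ ∀ i ∈ s, (ν i).Realize x) :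
    ∃ (A : Type (max u v w)) (_ : L.Structure A) (_ : Nonempty A) (x : α → A),
      InVariety E A ∧ φ.Realize x ∧ ∀ i ∈ S, (ν i).Realize x := by
  classical
  choose ι hι using fun e : Identity L =>
    exists_formula_realize_iff_identity.{u, v, max u v w} e α
  obtain ⟨A, _, _, x, hx⟩ := exists_realize_of_finitely_realizable.{u, v, w}
    (insert φ (ι '' E ∪ ν '' S)) fun s hs => by
      obtain ⟨t, ht, hts⟩ := Finset.subset_set_image_iff.1
        (show ↑(s.filter (· ∈ ν '' S)) ⊆ ν '' S from fun _ hψ => (Finset.mem_filter.1 hψ).2)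
      obtain ⟨A, hA, hne, x, hEA, hφ, hν⟩ := h t ht
      refine ⟨A, hA, hne, x, fun ψ hψ => ?_⟩
      rcases hs hψ with rfl | ⟨e, he, rfl⟩ | hψS
      · exact hφ
      · exact (hι e A x).2 (hEA e he)
      · have hψt : ψ ∈ t.image ν := hts ▸ Finset.mem_filter.2 ⟨hψ, hψS⟩
        obtain ⟨i, hi, rfl⟩ := Finset.mem_image.1 hψt
        exact hν i hi
  exact ⟨A, inferInstance, inferInstance, x,
    fun e he => (hι e A x).1 (hx _ (.inr (.inl ⟨e, he, rfl⟩))), hx _ (.inl rfl),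
    fun i hi => hx _ (.inr (.inr ⟨i, hi, rfl⟩))⟩

variable {E : Set (Identity L)}

theorem DefinesPrincipalCongruences.rel_iff_realize {φ : L.Formula (Fin 4)}
    (hφ : DefinesPrincipalCongruences.{u, v, w} E φ) {A : Type w} [L.Structure A] [Nonempty A]
    (hA : InVariety E A) (x : Fin 4 → A) :
    (principalCongruence L (x 0) (x 1)).r (x 2) (x 3) ↔ φ.Realize x := by
  rw [hφ A hA]
  have : ![x 0, x 1, x 2, x 3] = x := by
    ext i
    fin_cases i <;> rfl
  rw [this]

variable [L.IsAlgebraic]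

/-- The term algebra. -/
instance termStructure (α : Type*) : L.Structure (L.Term α) where
  funMap := Term.func
  RelMap r := isEmptyElim r

/-- Evaluation of terms as a homomorphism from the term algebra. -/
def realizeHom {A α : Type*} [L.Structure A] (x : α → A) : L.Term α →[L] A :=
  homOfMapFun (fun t => t.realize x) fun _ _ => rfl

/-- Failures of finitely many equations compatible with `(x₂, x₃) ∈ θ(x₀, x₁)` can be
witnessed simultaneously, in a direct product. -/
theorem HasFraserHorn.exists_simultaneous (h : HasFraserHorn.{u, v, w} E)
    (s : Finset (L.Term (Fin 4) × L.Term (Fin 4)))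
    (hs : ∀ e ∈ s, ∃ (A : Type w) (_ : L.Structure A) (_ : Nonempty A) (x : Fin 4 → A),
      InVariety E A ∧ (principalCongruence L (x 0) (x 1)).r (x 2) (x 3) ∧
        e.1.realize x ≠ e.2.realize x) :
    ∃ (A : Type w) (_ : L.Structure A) (_ : Nonempty A) (x : Fin 4 → A),
      InVariety E A ∧ (principalCongruence L (x 0) (x 1)).r (x 2) (x 3) ∧
        ∀ e ∈ s, e.1.realize x ≠ e.2.realize x := by
  classical
  induction s using Finset.induction_on with
  | empty =>
    exact ⟨PUnit, ⟨fun _ _ => PUnit.unit, fun r => isEmptyElim r⟩, inferInstance,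
      fun _ => PUnit.unit, fun _ _ _ => rfl, fun θ _ => θ.iseqv.refl _, by simp⟩
  | insert e s _ ih =>
    obtain ⟨A, _, _, x, hA, hx, hex⟩ := hs e (Finset.mem_insert_self _ _)
    obtain ⟨B, _, _, y, hB, hy, hey⟩ := ih fun e he => hs e (Finset.mem_insert_of_mem he)
    -- Any congruence of the product splits, so the pair is in it once each coordinate is in its
    -- factor.
    refine ⟨A × B, inferInstance, inferInstance, fun i => (x i, y i), hA.prod hB, fun θ hθ => ?_,
      fun e' he' heq => ?_⟩
    · obtain ⟨θ₁, θ₂, hθ'⟩ := h A B hA hB θ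
      rw [hθ'] at hθ ⊢
      exact ⟨hx θ₁ hθ.1, hy θ₂ hθ.2⟩
    · rw [Prod.ext_iff, realize_fst, realize_fst, realize_snd, realize_snd] at heq
      rcases Finset.mem_insert.1 he' with rfl | he'
      · exact hex heq.1
      · exact hey e' he' heq.2

/-- The equations that hold whenever `(x₂, x₃) ∈ θ(x₀, x₁)` in the variety. -/
def principalEquations (E : Set (Identity L)) : Set (L.Term (Fin 4) × L.Term (Fin 4)) :=
  {e | ∀ (A : Type w) [L.Structure A] [Nonempty A] (x : Fin 4 → A), InVariety E A →
    (principalCongruence L (x 0) (x 1)).r (x 2) (x 3) → e.1.realize x = e.2.realize x}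

/-- With definable principal congruences and the Fraser-Horn property there is a generic
instance of `(x₂, x₃) ∈ θ(x₀, x₁)`. -/
theorem HasFraserHorn.exists_generic (h : HasFraserHorn.{u, v, max u v w} E)
    (hE : HasDPC.{u, v, max u v w} E) :
    ∃ (A : Type (max u v w)) (_ : L.Structure A) (_ : Nonempty A) (x : Fin 4 → A),
      InVariety E A ∧ (principalCongruence L (x 0) (x 1)).r (x 2) (x 3) ∧
        ∀ e : L.Term (Fin 4) × L.Term (Fin 4), e.1.realize x = e.2.realize x →
          e ∈ principalEquations.{u, v, max u v w} E := by
  obtain ⟨φ, hφ⟩ := hE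
  obtain ⟨A, _, _, x, hA, hx, hex⟩ := exists_inVariety_realize_of_finitely_realizable.{u, v, w} E φ
    (fun e : L.Term (Fin 4) × L.Term (Fin 4) => (e.1.equal e.2).not)
    (principalEquations.{u, v, max u v w} E)ᶜ fun s hs => by
      obtain ⟨A, _, _, x, hA, hx, hex⟩ := h.exists_simultaneous s fun e he => by
        have := hs he
        simp only [principalEquations, Set.mem_compl_iff, Set.mem_ofPred_eq, not_forall] at this
        obtain ⟨A, hA, hne, x, hEA, hx, hex⟩ := this
        exact ⟨A, hA, hne, x, hEA, hx, hex⟩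
      refine ⟨A, inferInstance, inferInstance, x, hA, (hφ.rel_iff_realize hA x).1 hx,
        fun e he => ?_⟩
      rw [Formula.realize_not, Formula.realize_equal]
      exact hex e he
  refine ⟨A, inferInstance, inferInstance, x, hA, (hφ.rel_iff_realize hA x).2 hx,
    fun e he => by_contra fun hne => ?_⟩
  exact Formula.realize_not.1 (hex e hne) (Formula.realize_equal.2 he)

/-- Under the congruence extension property a quadruple satisfying all
`principalEquations` lies in the principal congruence. -/
theorem HasCEP.rel_of_principalEquations (hcep : HasCEP.{u, v, max u v w} E)
    (h : HasFraserHorn.{u, v, max u v w} E) (hE : HasDPC.{u, v, max u v w} E)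
    {A : Type (max u v w)} [L.Structure A] (x : Fin 4 → A)
    (hx : ∀ e ∈ principalEquations.{u, v, max u v w} E, e.1.realize x = e.2.realize x) :
    (principalCongruence L (x 0) (x 1)).r (x 2) (x 3) := by
  obtain ⟨M, _, _, y, hM, hy, hgen⟩ := h.exists_generic hE
  intro θ hθ
  let g : L.Term (Fin 4) →[L] M := realizeHom y
  let η : Congruence L (L.Term (Fin 4)) := θ.comap (realizeHom x)
  -- By genericity, an equation true at `y` is forced, hence true at `x`.
  have hg : ∀ s t, g s = g t → η.r s t := fun s t hst => by
    change θ.r (s.realize x) (t.realize x)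
    rw [hx (s, t) (hgen (s, t) hst)]
  let g' (t : L.Term (Fin 4)) : g.range := ⟨g t, t, rfl⟩
  have : Nonempty g.range := ⟨g' (.var 0)⟩
  obtain ⟨δ, hδ⟩ := hcep M hM g.range (η.mapRange g hg)
  have key (i j : Fin 4) : δ.r (y i) (y j) ↔ θ.r (x i) (x j) := by
    have := η.mapRange_rel_iff g hg (p := g' (.var i)) (q := g' (.var j)) rfl rfl
    exact (hδ _ _).symm.trans this
  exact (key 2 3).1 (hy δ ((key 0 1).2 hθ))

theorem HasCEP.hasEDPC (hcep : HasCEP.{u, v, max u v w} E)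
    (h : HasFraserHorn.{u, v, max u v w} E) (hE : HasDPC.{u, v, max u v w} E) :
    HasEDPC.{u, v, max u v w} E := by
  obtain ⟨φ, hφ⟩ := id hE
  obtain ⟨s, hsS, hs⟩ : ∃ s : Finset (L.Term (Fin 4) × L.Term (Fin 4)),
      ↑s ⊆ principalEquations.{u, v, max u v w} E ∧
        ∀ (A : Type (max u v w)) [L.Structure A] [Nonempty A] (x : Fin 4 → A), InVariety E A →
          (∀ e ∈ s, e.1.realize x = e.2.realize x) → φ.Realize x := by
    -- Otherwise compactness yields a quadruple satisfying all forced equations but not `φ`.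
    by_contra! hcon
    obtain ⟨A, _, _, x, hA, hx, hex⟩ :=
      exists_inVariety_realize_of_finitely_realizable.{u, v, w} E φ.not
        (fun e : L.Term (Fin 4) × L.Term (Fin 4) => e.1.equal e.2)
        (principalEquations.{u, v, max u v w} E) fun s hs => by
          obtain ⟨A, hA, hne, x, hEA, hex, hx⟩ := hcon s hs
          exact ⟨A, hA, hne, x, hEA, Formula.realize_not.2 hx,
            fun e he => Formula.realize_equal.2 (hex e he)⟩
    exact Formula.realize_not.1 hx <| (hφ.rel_iff_realize hA x).1 <|
      hcep.rel_of_principalEquations h hE x fun e he => Formula.realize_equal.1 (hex e he)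
  obtain ⟨ψ, hψ, hψs⟩ := exists_isConjAtomic_realize_iff.{u, v, max u v w} s
  refine ⟨ψ, hψ, fun A _ _ hA a b c d => ?_⟩
  rw [hψs]
  refine ⟨fun hcd e he => hsS he A ![a, b, c, d] hA hcd, fun hex => ?_⟩
  exact (hφ.rel_iff_realize hA ![a, b, c, d]).2 (hs A _ hA hex)

end ToEDPC

end UniversalAlgebra

theorem mainTheorem7 (L : FirstOrder.Language.{u, v}) [L.IsAlgebraic]
    (E : Set (UniversalAlgebra.Identity L))
    (hE : UniversalAlgebra.HasDPC.{u, v, max u v w} E) :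
    UniversalAlgebra.HasEDPC.{u, v, max u v w} E ↔
      UniversalAlgebra.HasCEP.{u, v, max u v w} E ∧
        UniversalAlgebra.HasFraserHorn.{u, v, max u v w} E :=
  ⟨fun h => ⟨h.hasCEP, h.hasFraserHorn⟩, fun h => h.1.hasEDPC h.2 hE⟩
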